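/- A tournament is a directed graph without loops in which, for any two distinct vertices $v,w$, exactly one of $(v,w)$, $(w,v)$ is an edge; it is transitive if it contains no directed cycle. For a tournament $H$, a tournament is called $H$-free if none of its (induced) subtournaments is isomorphic to $H$. Let $C_5$ be the tournament with vertex set $\mathbb{Z}/5\mathbb{Z}$ and edges $(i,i+1)$ and $(i,i+2)$ for $i\in\mathbb{Z}/5\mathbb{Z}$ (up to isomorphism, the unique five-vertex tournament in which every vertex has exactly two outneighbours and two inneighbours). Let $L_2$ be the six-vertex tournament obtained from $C_5$ by adding one extra vertex whose inneighbours are $0,1,3$, which form a cyclic triangle of $C_5$, and whose outneighbours are $2,4$. (Up to isomorphism, the choice of the cyclic triangle does not matter.) **Theorem.** The tournament $L_2$ has the Erdős–Hajnal property: there exists $\epsilon>0$ such that, for every $n$, every $L_2$-free tournament on $n$ vertices contains a transitive subtournament on at least $n^{\epsilon}$ vertices. -/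

import Mathlib

universe u

/-- A tournament on `V`: a loopless directed graph in which, for any two distinct vertices,
exactly one of the two possible edges is present. -/
structure Tournament (V : Type*) extends Digraph V where
  loopless : ∀ v, ¬ Adj v v
  adj_xor : ∀ v w, v ≠ w → Xor (Adj v w) (Adj w v)

namespace Tournament

/-- The subtournament of `T` induced on a set `S` of vertices. -/
def induce {V : Type*} (T : Tournament V) (S : Set V) : Tournament S where
  Adj v w := T.Adj v w
  loopless v := T.loopless v
  adj_xor v w h := T.adj_xor v w (fun e => h (Subtype.ext e))

/-- A tournament is transitive if it contains no directed cycle, i.e. no vertex can be reached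
from itself by a directed walk of positive length. -/
def IsTransitive {V : Type*} (T : Tournament V) : Prop :=
  ∀ v, ¬ Relation.TransGen T.Adj v v

/-- `T` is `H`-free if no subtournament of `T` is isomorphic to `H`. -/
def IsFree {V W : Type*} (T : Tournament V) (H : Tournament W) : Prop :=
  ¬ ∃ S : Set V, Nonempty (H.Adj ≃r (T.induce S).Adj)

/-- `H` has the Erdős–Hajnal property: for some `ε > 0`, every `H`-free tournament on `n` vertices
contains a transitive subtournament on at least `n ^ ε` vertices. -/
def HasErdosHajnalProperty {W : Type*} (H : Tournament W) : Prop :=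
  ∃ ε : ℝ, 0 < ε ∧ ∀ (V : Type u) [Fintype V] (T : Tournament V), T.IsFree H →
    ∃ S : Finset V, (T.induce (S : Set V)).IsTransitive ∧
      (Fintype.card V : ℝ) ^ ε ≤ (S.card : ℝ)

/-- The tournament obtained from `T` by adding one extra vertex `none`, whose inneighbours are the
vertices in `S` and whose outneighbours are the other vertices of `T`. -/
def addVertex {V : Type*} (T : Tournament V) (S : Set V) : Tournament (Option V) where
  Adj
    | some v, some w => T.Adj v w
    | some v, none => v ∈ S
    | none, some w => w ∉ S
    | none, none => False
  loopless
    | some v => T.loopless v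
    | none => id
  adj_xor
    | some v, some w, h => T.adj_xor v w (fun e => h (congrArg some e))
    | some v, none, _ => by by_cases hv : v ∈ S <;> simp [Xor, hv]
    | none, some w, _ => by by_cases hw : w ∈ S <;> simp [Xor, hw]
    | none, none, h => absurd rfl h

/-- The regular tournament on five vertices: `i → i + 1` and `i → i + 2` modulo `5`. -/
def C5 : Tournament (ZMod 5) where
  Adj i j := j = i + 1 ∨ j = i + 2
  loopless := by decide
  adj_xor := by unfold Xor; decide

/-- Every vertex of `C5` has exactly two outneighbours and exactly two inneighbours. -/
theorem C5_regular (i : ZMod 5) :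
    {j | C5.Adj i j} = {i + 1, i + 2} ∧ {j | C5.Adj j i} = {i - 1, i - 2} ∧
      i + 1 ≠ i + 2 ∧ i - 1 ≠ i - 2 := by
  refine ⟨rfl, ?_, ?_, ?_⟩
  · ext j
    change (i = j + 1 ∨ i = j + 2) ↔ (j = i - 1 ∨ j = i - 2)
    revert i j
    decide
  · revert i
    decide
  · revert i
    decide

/-- The vertices `0, 1, 3` of `C5` form a cyclic triangle. -/
theorem C5_cyclic_triangle : C5.Adj 0 1 ∧ C5.Adj 1 3 ∧ C5.Adj 3 0 := by
  refine ⟨Or.inl ?_, Or.inr ?_, Or.inr ?_⟩ <;> decide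

/-- The tournament `L₂`: `C5` with one extra vertex whose inneighbours are the vertices `0, 1, 3`,
which form a cyclic triangle. -/
def L2 : Tournament (Option (ZMod 5)) := C5.addVertex {0, 1, 3}

end Tournament

namespace Tournament

section
open scoped Classical
open Finset

variable {V : Type u}

/-! Take a minimal counterexample `S` and put `N = |S| ^ ε`. No transitive subset of `S` has `N`
vertices, but for small `ε` every proper subset of a fixed positive proportion contains one with
`0.99 * N` vertices. So two disjoint proper subsets of such size cannot have all edges going from
one to the other: the two transitive sets would combine.

Excluding a fixed tournament gives five blocks of linear size with few backward edges
(`exists_sparse_blocks`). The middle block contains a transitive set `Q` of size `0.99 * N`, cut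
into six consecutive pieces. Almost every vertex of another block has a backward neighbour in each
piece, since otherwise `0.99 * N` and more than `N / 100` vertices would combine.

These backward neighbours, with one typical vertex from each of the second and fourth blocks, almost
complete copies of `L2`. Consequently the ends of any backward edge between large parts of the first
and last blocks have the same backward neighbours in a large part of one piece
(`backward_nbrs_agree`). A subset of that part covering a moderate share of the first block then
separates covered from uncovered vertices, and two large sets have no backward edge between them
(`exists_empty_pair`), a contradiction. -/

/-! ### Copies of a tournament -/

theorem adj_ne {T : Tournament V} {v w : V} (h : T.Adj v w) : v ≠ w := by
  rintro rfl
  exact T.loopless v h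

theorem adj_asymm {T : Tournament V} {v w : V} (h : T.Adj v w) : ¬ T.Adj w v := by
  rcases T.adj_xor v w (adj_ne h) with h' | h'
  · exact h'.2
  · exact fun _ => h'.2 h

theorem adj_of_not_adj {T : Tournament V} {v w : V} (hne : v ≠ w) (h : ¬ T.Adj w v) :
    T.Adj v w := by
  rcases T.adj_xor v w hne with h' | h'
  · exact h'.1
  · exact absurd h'.1 h

/-- A homomorphism between tournaments is an embedding. -/
theorem not_isFree_of_hom {W : Type*} {T : Tournament V} {H : Tournament W} (f : W → V)
    (hf : ∀ a b, H.Adj a b → T.Adj (f a) (f b)) : ¬ T.IsFree H := by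
  have hinj : Function.Injective f := by
    intro a b hab
    by_contra hne
    rcases H.adj_xor a b hne with h | h
    · exact adj_ne (hf _ _ h.1) hab
    · exact adj_ne (hf _ _ h.1) hab.symm
  refine fun h => h ⟨Set.range f, ⟨⟨Equiv.ofInjective f hinj, ?_⟩⟩⟩
  intro a b
  constructor
  · intro (hab : T.Adj (f a) (f b))
    refine adj_of_not_adj (fun e => adj_ne hab (congrArg f e)) fun hba => ?_
    exact adj_asymm (hf _ _ hba) hab
  · exact hf a b

/-- Ten edges of `C5` and five at the extra vertex `y` suffice, because a homomorphism of
tournaments is automatically an embedding. -/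
theorem not_isFree_L2 {T : Tournament V} {x₀ x₁ x₂ x₃ x₄ y : V}
    (h01 : T.Adj x₀ x₁) (h02 : T.Adj x₀ x₂) (h12 : T.Adj x₁ x₂) (h13 : T.Adj x₁ x₃)
    (h23 : T.Adj x₂ x₃) (h24 : T.Adj x₂ x₄) (h34 : T.Adj x₃ x₄) (h30 : T.Adj x₃ x₀)
    (h40 : T.Adj x₄ x₀) (h41 : T.Adj x₄ x₁) (h0y : T.Adj x₀ y) (h1y : T.Adj x₁ y)
    (h3y : T.Adj x₃ y) (hy2 : T.Adj y x₂) (hy4 : T.Adj y x₄) : ¬ T.IsFree L2 := by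
  have key : ∀ i j : Fin 5, C5.Adj i j →
      T.Adj (![x₀, x₁, x₂, x₃, x₄] i) (![x₀, x₁, x₂, x₃, x₄] j) := by
    intro i j h
    have h' : j = (i + 1 : Fin 5) ∨ j = (i + 2 : Fin 5) := h
    clear h
    rcases h' with rfl | rfl <;> fin_cases i <;> assumption
  have hin : ∀ i : Fin 5, i ∈ ({0, 1, 3} : Set (ZMod 5)) → T.Adj (![x₀, x₁, x₂, x₃, x₄] i) y := by
    rintro i (rfl | rfl | rfl) <;> assumption
  have hout : ∀ i : Fin 5, i ∉ ({0, 1, 3} : Set (ZMod 5)) →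
      T.Adj y (![x₀, x₁, x₂, x₃, x₄] i) := by
    intro i hi
    fin_cases i
    · exact absurd (Or.inl rfl) hi
    · exact absurd (Or.inr (Or.inl rfl)) hi
    · exact hy2
    · exact absurd (Or.inr (Or.inr rfl)) hi
    · exact hy4
  refine not_isFree_of_hom
    (fun a => a.elim y (fun i : ZMod 5 => ![x₀, x₁, x₂, x₃, x₄] (i : Fin 5))) ?_
  rintro (_ | i) (_ | j) h
  · exact absurd h id
  · exact hout j h
  · exact hin i h
  · exact key i j h

/-! ### Counting edges and union bounds -/

/-- The number of pairs in `A × B` related by `r`. -/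
noncomputable def relCount {α β : Type*} (r : α → β → Prop) (A : Finset α) (B : Finset β) : ℕ :=
  ∑ a ∈ A, #{b ∈ B | r a b}

theorem relCount_swap {α β : Type*} (r : α → β → Prop) (A : Finset α) (B : Finset β) :
    relCount (fun b a => r a b) B A = relCount r A B :=
  (sum_card_bipartiteAbove_eq_sum_card_bipartiteBelow r).symm

theorem relCount_mono {α β : Type*} {r : α → β → Prop} {A A' : Finset α} {B B' : Finset β}
    (hA : A' ⊆ A) (hB : B' ⊆ B) : relCount r A' B' ≤ relCount r A B :=
  (sum_le_sum fun _ _ => card_le_card (filter_subset_filter _ hB)).trans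
    (sum_le_sum_of_subset hA)

/-- Few elements of `A` have large degree if the relation is sparse. -/
theorem card_large_degree_le {α β : Type*} {r : α → β → Prop} {A : Finset α} {B : Finset β}
    {K M : ℕ} (h : K * M * relCount r A B ≤ #A * #B) :
    K * #{a ∈ A | #B < M * #{b ∈ B | r a b}} ≤ #A := by
  rcases B.eq_empty_or_nonempty with rfl | hB
  · simp
  have h1 : #{a ∈ A | #B < M * #{b ∈ B | r a b}} * #B ≤ M * relCount r A B := by
    calc _ = ∑ a ∈ A with #B < M * #{b ∈ B | r a b}, #B := by simp
      _ ≤ ∑ a ∈ A with #B < M * #{b ∈ B | r a b}, M * #{b ∈ B | r a b} :=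
        sum_le_sum fun a ha => (mem_filter.1 ha).2.le
      _ ≤ ∑ a ∈ A, M * #{b ∈ B | r a b} := sum_le_sum_of_subset (filter_subset _ _)
      _ = _ := by rw [relCount, mul_sum]
  refine Nat.le_of_mul_le_mul_right (c := #B) ?_ hB.card_pos
  calc _ = K * (#{a ∈ A | #B < M * #{b ∈ B | r a b}} * #B) := by ring
    _ ≤ K * (M * relCount r A B) := Nat.mul_le_mul_left _ h1
    _ ≤ _ := by rw [← mul_assoc]; exact h

/-- Union bound: at least half of the elements avoid few small sets. -/
theorem exists_subset_avoid {α : Type*} {B : Finset α} (l : List (Finset α)) (hl : l.length ≤ 10)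
    (h : ∀ s ∈ l, 20 * #s ≤ #B) : ∃ A ⊆ B, #B ≤ 2 * #A ∧ ∀ y ∈ A, ∀ s ∈ l, y ∉ s := by
  have key : ∀ l : List (Finset α), (∀ s ∈ l, 20 * #s ≤ #B) →
      20 * #{y ∈ B | ∃ s ∈ l, y ∈ s} ≤ l.length * #B := by
    intro l
    induction l with
    | nil => simp
    | cons s l ih =>
      intro h
      obtain ⟨hs, hl⟩ := List.forall_mem_cons.1 h
      have hsub : {y ∈ B | ∃ s' ∈ s :: l, y ∈ s'} ⊆ s ∪ {y ∈ B | ∃ s ∈ l, y ∈ s} := by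
        intro y
        simp only [mem_filter, mem_union, List.mem_cons, exists_eq_or_imp]
        tauto
      have h1 := (card_le_card hsub).trans (card_union_le _ _)
      have h2 := ih hl
      rw [List.length_cons, add_one_mul l.length]
      omega
  have h1 := (key l h).trans (Nat.mul_le_mul_right _ hl)
  have h2 := card_filter_add_card_filter_not (s := B) (fun y => ∃ s ∈ l, y ∈ s)
  refine ⟨{y ∈ B | ¬ ∃ s ∈ l, y ∈ s}, filter_subset _ _, by omega, fun y hy s hs hys => ?_⟩
  exact (mem_filter.1 hy).2 ⟨s, hs, hys⟩

/-! ### Sparse pairs and sparse blocks -/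

/-- Either the pattern `R` can be embedded in the sets `C i`, or two of them contain large subsets
between which almost all edges go in one direction. -/
theorem embed_or_sparse_pair {D : ℕ} (hD : 0 < D) (h : ℕ) (R : Fin h → Fin h → Prop) :
    ∃ K : ℕ, ∀ (V : Type u) (T : Tournament V) (C : Fin h → Finset V) (m : ℕ), 0 < m →
      (∀ i, m ≤ #(C i)) →
      (∃ f : Fin h → V, (∀ i, f i ∈ C i) ∧
        ∀ i j, i < j → (R i j → T.Adj (f i) (f j)) ∧ (¬ R i j → T.Adj (f j) (f i))) ∨
      ∃ i j, i ≠ j ∧ ∃ A ⊆ C i, ∃ B ⊆ C j, m ≤ K * #A ∧ m ≤ K * #B ∧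
        D * relCount (fun a b => T.Adj b a) A B ≤ #A * #B := by
  induction h with
  | zero => exact ⟨0, fun V T C m _ _ => Or.inl ⟨Fin.elim0, fun i => i.elim0, fun i => i.elim0⟩⟩
  | succ h ih =>
    obtain ⟨K, hK⟩ := ih fun i j => R i.succ j.succ
    refine ⟨D * K + h + 1, fun V T C m hm hC => ?_⟩
    let cor : Fin h → V → V → Prop := fun j v w =>
      (R 0 j.succ → T.Adj v w) ∧ (¬ R 0 j.succ → T.Adj w v)
    by_cases hgood : ∃ v ∈ C 0, ∀ j, #(C j.succ) ≤ D * #{w ∈ C j.succ | cor j v w}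
    · obtain ⟨v, hv, hvg⟩ := hgood
      -- `m'` is `m / D` rounded up, a lower bound for the parts of the `C j.succ` correctly joined
      -- to `v`.
      obtain ⟨m', hm', hmm'⟩ : ∃ m', m ≤ D * m' ∧ ∀ k, m ≤ D * k → m' ≤ k := by
        have hex : ∃ k, m ≤ D * k := ⟨m, Nat.le_mul_of_pos_left m hD⟩
        exact ⟨Nat.find hex, Nat.find_spec hex, fun k hk => Nat.find_min' hex hk⟩
      have hpos : 0 < m' := by
        rcases Nat.eq_zero_or_pos m' with rfl | h0
        · omega
        · exact h0
      rcases hK V T (fun j => {w ∈ C j.succ | cor j v w}) m' hpos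
        (fun j => hmm' _ ((hC j.succ).trans (hvg j))) with ⟨f, hf, hfR⟩ |
          ⟨i, j, hij, A, hA, B, hB, h1, h2, h3⟩
      · refine Or.inl ⟨Fin.cons v f, ?_, ?_⟩
        · intro i
          refine Fin.cases hv (fun i => ?_) i
          exact (mem_filter.1 (hf i)).1
        · intro i j
          refine Fin.cases ?_ (fun j => ?_) j
          · intro hlt
            exact absurd hlt (Fin.not_lt_zero i)
          · refine Fin.cases (fun _ => ?_) (fun i => ?_) i
            · exact (mem_filter.1 (hf j)).2
            · intro hlt
              exact hfR i j (Fin.succ_lt_succ_iff.1 hlt)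
      · have hle : ∀ x, m' ≤ K * x → m ≤ (D * K + h + 1) * x := by
          intro x hx
          calc m ≤ D * m' := hm'
            _ ≤ D * (K * x) := Nat.mul_le_mul_left _ hx
            _ ≤ (D * K + h + 1) * x := by rw [← mul_assoc]; exact Nat.mul_le_mul_right _ (by omega)
        exact Or.inr ⟨i.succ, j.succ, fun e => hij (Fin.succ_injective _ e), A,
          hA.trans (filter_subset _ _), B, hB.trans (filter_subset _ _), hle _ h1, hle _ h2, h3⟩
    · right
      push Not at hgood
      -- Every vertex of `C 0` fails for some `j`; pigeonhole over the `h` indices.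
      obtain ⟨j, hj⟩ : ∃ j : Fin h, #(C 0) ≤
          h * #{v ∈ C 0 | D * #{w ∈ C j.succ | cor j v w} < #(C j.succ)} := by
        by_contra! hcon
        have hsub : C 0 ⊆ univ.biUnion fun j : Fin h =>
            {v ∈ C 0 | D * #{w ∈ C j.succ | cor j v w} < #(C j.succ)} := by
          intro v hv
          obtain ⟨j, hj⟩ := hgood v hv
          exact mem_biUnion.2 ⟨j, mem_univ _, mem_filter.2 ⟨hv, hj⟩⟩
        obtain ⟨v, hv⟩ : (C 0).Nonempty := card_pos.1 (hm.trans_le (hC 0))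
        obtain ⟨j₀, -⟩ := hgood v hv
        have h1 := (card_le_card hsub).trans card_biUnion_le
        have h2 : ∑ j : Fin h, h * #{v ∈ C 0 | D * #{w ∈ C j.succ | cor j v w} < #(C j.succ)}
            < ∑ j : Fin h, #(C 0) := sum_lt_sum_of_nonempty ⟨j₀, mem_univ _⟩ fun j _ => hcon j
        rw [← mul_sum, sum_const, card_univ, Fintype.card_fin, smul_eq_mul] at h2
        exact absurd (Nat.mul_le_mul_left h h1) (not_le.2 h2)
      set A := {v ∈ C 0 | D * #{w ∈ C j.succ | cor j v w} < #(C j.succ)} with hA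
      have hmA : m ≤ (D * K + h + 1) * #A :=
        (hC 0).trans (hj.trans (Nat.mul_le_mul_right _ (by omega)))
      have hmB : m ≤ (D * K + h + 1) * #(C j.succ) :=
        (hC j.succ).trans (Nat.le_mul_of_pos_left _ (by omega))
      have hcount : D * relCount (cor j) A (C j.succ) ≤ #A * #(C j.succ) := by
        rw [relCount, mul_sum, ← smul_eq_mul, ← sum_const]
        refine sum_le_sum fun v hv => ?_
        convert (mem_filter.1 hv).2.le
      -- The rare edges are those in the direction the pattern asks for, so the pattern decides
      -- which set comes first in the pair.
      by_cases hR : R 0 j.succ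
      · have e : cor j = fun v w => T.Adj v w := by
          funext v w
          simp [cor, hR]
        rw [e, ← relCount_swap, mul_comm (#A)] at hcount
        exact ⟨j.succ, 0, Fin.succ_ne_zero j, _, Subset.rfl, A, filter_subset _ _, hmB, hmA, hcount⟩
      · have e : cor j = fun v w => T.Adj w v := by
          funext v w
          simp [cor, hR]
        rw [e] at hcount
        exact ⟨0, j.succ, (Fin.succ_ne_zero j).symm, A, filter_subset _ _, _, Subset.rfl,
          hmA, hmB, hcount⟩

theorem exists_disjoint_subsets {α : Type*} {S : Finset α} {k m : ℕ} (h : k * m ≤ #S) :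
    ∃ P : Fin k → Finset α, (∀ i, P i ⊆ S) ∧ (∀ i, #(P i) = m) ∧
      ∀ i j, i ≠ j → Disjoint (P i) (P j) := by
  obtain ⟨g⟩ : Nonempty (Fin k × Fin m ↪ S) :=
    Function.Embedding.nonempty_of_card_le (by simpa using h)
  refine ⟨fun i => univ.image fun j => (g (i, j) : α), ?_, ?_, ?_⟩
  · intro i x hx
    obtain ⟨j, -, rfl⟩ := mem_image.1 hx
    exact (g (i, j)).2
  · intro i
    rw [card_image_of_injective, card_univ, Fintype.card_fin]
    intro j j' hjj
    simpa using g.injective (Subtype.ext hjj)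
  · intro i j hij
    rw [disjoint_left]
    intro x hx hx'
    obtain ⟨a, -, rfl⟩ := mem_image.1 hx
    obtain ⟨b, -, hb⟩ := mem_image.1 hx'
    have := g.injective (Subtype.ext hb)
    exact hij (Prod.ext_iff.1 this).1.symm

/-- A tournament excluding `H` contains two large sets with very few edges from the second to the
first. -/
theorem exists_sparse_pair {W : Type*} [Fintype W] (H : Tournament W) {D : ℕ} (hD : 0 < D) :
    ∃ K : ℕ, ∀ (V : Type u) (T : Tournament V), T.IsFree H →
      ∀ S : Finset V, Fintype.card W < #S →
        ∃ A ⊆ S, ∃ B ⊆ S, Disjoint A B ∧ #S ≤ K * #A ∧ #S ≤ K * #B ∧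
          D * relCount (fun a b => T.Adj b a) A B ≤ #A * #B := by
  obtain ⟨h, hh⟩ : ∃ h, h = Fintype.card W := ⟨_, rfl⟩
  obtain ⟨e⟩ : Nonempty (W ≃ Fin h) := ⟨Fintype.equivFinOfCardEq hh.symm⟩
  rw [← hh]
  obtain ⟨K, hK⟩ := embed_or_sparse_pair.{u} hD h
    fun i j => H.Adj (e.symm i) (e.symm j)
  -- The parts have `#S / (h + 1)` vertices; rounding down costs at most the factor 2, and `h + 1`
  -- also covers `h = 0`.
  refine ⟨(h + 1) * 2 * K, fun V T hT S hS => ?_⟩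
  have hdiv : (h + 1) * (#S / (h + 1)) ≤ #S := Nat.mul_div_le _ _
  have hm : 0 < #S / (h + 1) := Nat.div_pos hS (by omega)
  have hlt : #S < (h + 1) * 2 * (#S / (h + 1)) := by
    have := Nat.lt_mul_div_succ #S (show 0 < h + 1 by omega)
    nlinarith
  obtain ⟨P, hPS, hPm, hPd⟩ := exists_disjoint_subsets (k := h)
    ((Nat.mul_le_mul_right _ (Nat.le_succ h)).trans hdiv)
  rcases hK V T P _ hm (fun i => (hPm i).ge) with ⟨f, -, hf⟩ | ⟨i, j, hij, A, hA, B, hB, h1, h2, h3⟩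
  · refine absurd hT (not_isFree_of_hom (fun a => f (e a)) fun a b hab => ?_)
    rcases lt_trichotomy (e a) (e b) with hlt | heq | hgt
    · exact (hf _ _ hlt).1 (by simpa using hab)
    · rw [e.injective heq] at hab
      exact absurd hab (H.loopless b)
    · exact (hf _ _ hgt).2 (by simpa using adj_asymm hab)
  · have hle : ∀ x, #S / (h + 1) ≤ K * x → #S ≤ (h + 1) * 2 * K * x := by
      intro x hx
      rw [mul_assoc _ K]
      exact hlt.le.trans (Nat.mul_le_mul_left _ hx)
    exact ⟨A, hA.trans (hPS i), B, hB.trans (hPS j),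
      (hPd i j hij).mono hA hB, hle _ h1, hle _ h2, h3⟩

/-- A tournament excluding `H` contains a long sequence of large sets with very few edges from
later sets to earlier ones. -/
theorem exists_sparse_blocks {W : Type*} [Fintype W] (H : Tournament W) (k : ℕ) {D : ℕ}
    (hD : 0 < D) :
    ∃ K N : ℕ, 0 < K ∧ ∀ (V : Type u) (T : Tournament V), T.IsFree H →
      ∀ S : Finset V, N ≤ #S →
        ∃ A : Fin k → Finset V, (∀ i, A i ⊆ S) ∧ (∀ i, #S ≤ K * #(A i)) ∧
          ∀ i j, i < j → Disjoint (A i) (A j) ∧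
            D * relCount (fun a b => T.Adj b a) (A i) (A j) ≤ #(A i) * #(A j) := by
  induction k with
  | zero =>
    exact ⟨1, 0, one_pos, fun V T _ S _ => ⟨Fin.elim0, fun i => i.elim0, fun i => i.elim0,
      fun i => i.elim0⟩⟩
  | succ k ih =>
    obtain ⟨K, N, hK, hKN⟩ := ih
    -- Later blocks fill only a `1 / K` share of `B`, which can raise the density by a factor `K`;
    -- hence `D * K`.
    obtain ⟨L, hL⟩ := exists_sparse_pair.{u} H (D := D * K) (by positivity)
    refine ⟨L * K + 1, L * N + Fintype.card W + 1, by omega, fun V T hT S hS => ?_⟩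
    obtain ⟨A, hAS, B, hBS, hAB, hA, hB, hsp⟩ := hL V T hT S (by omega)
    have hNB : N ≤ #B := by
      by_contra! hlt
      have := Nat.mul_le_mul_left L hlt.le
      omega
    obtain ⟨C, hCB, hC, hCC⟩ := hKN V T hT B hNB
    refine ⟨Fin.cons A C, ?_, ?_, ?_⟩
    · intro i
      refine Fin.cases hAS (fun i => ?_) i
      exact (hCB i).trans hBS
    · intro i
      refine Fin.cases ?_ (fun i => ?_) i
      · refine hA.trans (Nat.mul_le_mul_right _ ?_)
        have := Nat.le_mul_of_pos_right L hK
        omega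
      · calc #S ≤ L * #B := hB
          _ ≤ L * (K * #(C i)) := Nat.mul_le_mul_left _ (hC i)
          _ ≤ (L * K + 1) * #(C i) := by rw [← mul_assoc]; exact Nat.mul_le_mul_right _ (by omega)
    · intro i j
      refine Fin.cases ?_ (fun j => ?_) j
      · intro hlt
        exact absurd hlt (Fin.not_lt_zero i)
      · refine Fin.cases (fun _ => ?_) (fun i => ?_) i
        · refine ⟨hAB.mono_right (hCB j), ?_⟩
          simp only [Fin.cons_zero, Fin.cons_succ]
          refine Nat.le_of_mul_le_mul_right (c := K) ?_ hK
          calc D * relCount (fun a b => T.Adj b a) A (C j) * K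
              ≤ D * K * relCount (fun a b => T.Adj b a) A B := by
                rw [mul_right_comm]
                exact Nat.mul_le_mul_left _ (relCount_mono Subset.rfl (hCB j))
            _ ≤ #A * #B := hsp
            _ ≤ #A * (K * #(C j)) := Nat.mul_le_mul_left _ (hC j)
            _ = _ := by ring
        · intro hlt
          exact hCC i j (Fin.succ_lt_succ_iff.1 hlt)

/-! ### Transitive sets -/

/-- The vertices of `Q` induce a transitive subtournament. -/
def TransOn (T : Tournament V) (Q : Finset V) : Prop :=
  ∀ a ∈ Q, ∀ b ∈ Q, ∀ c ∈ Q, T.Adj a b → T.Adj b c → T.Adj a c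

theorem TransOn.mono {T : Tournament V} {Q Q' : Finset V} (h : T.TransOn Q) (hQ : Q' ⊆ Q) :
    T.TransOn Q' :=
  fun a ha b hb c hc => h a (hQ ha) b (hQ hb) c (hQ hc)

theorem TransOn.union {T : Tournament V} {P Q : Finset V} (hP : T.TransOn P) (hQ : T.TransOn Q)
    (h : ∀ p ∈ P, ∀ q ∈ Q, T.Adj p q) : T.TransOn (P ∪ Q) := by
  intro a ha b hb c hc hab hbc
  rcases mem_union.1 ha with ha | ha <;> rcases mem_union.1 hb with hb | hb <;>
    rcases mem_union.1 hc with hc | hc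
  · exact hP a ha b hb c hc hab hbc
  · exact h a ha c hc
  · exact absurd hbc (adj_asymm (h c hc b hb))
  · exact h a ha c hc
  · exact absurd hab (adj_asymm (h b hb a ha))
  · exact absurd hab (adj_asymm (h b hb a ha))
  · exact absurd hbc (adj_asymm (h c hc b hb))
  · exact hQ a ha b hb c hc hab hbc

/-- Transitivity collapses a directed walk to a single edge, so a closed walk would be a loop. -/
theorem TransOn.isTransitive {T : Tournament V} {Q : Finset V} (h : T.TransOn Q) :
    (T.induce (Q : Set V)).IsTransitive := by
  have key : ∀ a b : (Q : Set V), Relation.TransGen (T.induce (Q : Set V)).Adj a b →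
      T.Adj a b := by
    intro a b hab
    induction hab with
    | single hab => exact hab
    | @tail b c _ hbc ih => exact h a (mem_coe.1 a.2) b (mem_coe.1 b.2) c (mem_coe.1 c.2) ih hbc
  exact fun v hv => T.loopless v (key v v hv)

/-- A transitive set can be cut into consecutive pieces. -/
theorem TransOn.exists_pieces {T : Tournament V} {Q : Finset V} (hQ : T.TransOn Q) {k m : ℕ}
    (h : k * m ≤ #Q) :
    ∃ P : Fin k → Finset V, (∀ i, P i ⊆ Q) ∧ (∀ i, #(P i) = m) ∧
      ∀ i j, i < j → ∀ p ∈ P i, ∀ q ∈ P j, T.Adj p q := by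
  -- The in-degree within `Q` is the position in the linear order, and takes each value below `#Q`
  -- exactly once.
  set rk : V → ℕ := fun q => #{p ∈ Q | T.Adj p q} with hrk
  have hlt : ∀ p ∈ Q, ∀ q ∈ Q, T.Adj p q → rk p < rk q := by
    intro p hp q hq hpq
    refine card_lt_card ⟨fun x hx => ?_, fun hsub => ?_⟩
    · obtain ⟨hx, hxp⟩ := mem_filter.1 hx
      exact mem_filter.2 ⟨hx, hQ x hx p hp q hq hxp hpq⟩
    · exact T.loopless p (mem_filter.1 (hsub (mem_filter.2 ⟨hp, hpq⟩))).2
  have hinj : Set.InjOn rk Q := by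
    intro p hp q hq hpq
    by_contra hne
    by_cases hadj : T.Adj p q
    · exact (hlt p hp q hq hadj).ne hpq
    · exact (hlt q hq p hp (adj_of_not_adj (Ne.symm hne) hadj)).ne hpq.symm
  have himage : Q.image rk = range #Q := by
    refine eq_of_subset_of_card_le ?_ (by rw [card_image_of_injOn hinj, card_range])
    intro x hx
    obtain ⟨q, hq, rfl⟩ := mem_image.1 hx
    refine mem_range.2 (card_lt_card ⟨filter_subset _ _, fun hsub => ?_⟩)
    exact T.loopless q (mem_filter.1 (hsub hq)).2
  refine ⟨fun i => {q ∈ Q | i * m ≤ rk q ∧ rk q < (i + 1) * m}, fun i => filter_subset _ _, ?_, ?_⟩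
  · intro i
    have hI : ({q ∈ Q | i * m ≤ rk q ∧ rk q < (i + 1) * m}).image rk
        = Ico (i * m) ((i + 1) * m) := by
      ext x
      simp only [mem_image, mem_filter, mem_Ico]
      constructor
      · rintro ⟨q, ⟨-, hq⟩, rfl⟩
        exact hq
      · intro hx
        have : x ∈ Q.image rk := by
          rw [himage, mem_range]
          exact hx.2.trans_le ((Nat.mul_le_mul_right m i.2).trans h)
        obtain ⟨q, hq, rfl⟩ := mem_image.1 this
        exact ⟨q, ⟨hq, hx⟩, rfl⟩
    rw [← card_image_of_injOn (hinj.mono (coe_subset.2 (filter_subset _ _))), hI, Nat.card_Ico,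
      Nat.succ_mul, Nat.add_sub_cancel_left]
  · intro i j hij p hp q hq
    obtain ⟨hp, -, hpi⟩ := mem_filter.1 hp
    obtain ⟨hq, hqj, -⟩ := mem_filter.1 hq
    have hpq : rk p < rk q := hpi.trans_le ((Nat.mul_le_mul_right m hij).trans hqj)
    refine adj_of_not_adj (fun e => hpq.ne (congrArg rk e)) fun hqp => ?_
    exact (hlt q hq p hp hqp).asymm hpq

/-! ### Backward neighbours and empty pairs -/

/-- Three orderings of `L2` force the two ends of a backward edge `y₅ → y₀` to have the same
backward neighbours in the middle of a transitive set. -/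
theorem backward_nbrs_agree {T : Tournament V} (hT : T.IsFree L2)
    {y₀ y₁ y₄ y₅ p p' q b b' d d' : V}
    (h50 : T.Adj y₅ y₀) (h01 : T.Adj y₀ y₁) (h04 : T.Adj y₀ y₄) (h15 : T.Adj y₁ y₅)
    (h45 : T.Adj y₄ y₅)
    (h1p : T.Adj y₁ p) (h1p' : T.Adj y₁ p') (h1q : T.Adj y₁ q)
    (hp4 : T.Adj p y₄) (hp'4 : T.Adj p' y₄) (hq4 : T.Adj q y₄)
    (hb1 : T.Adj b y₁) (hb0 : T.Adj y₀ b) (hb5 : T.Adj b y₅)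
    (hb'1 : T.Adj b' y₁) (hb'0 : T.Adj y₀ b') (hb'5 : T.Adj b' y₅)
    (hd4 : T.Adj y₄ d) (hd0 : T.Adj y₀ d) (hd5 : T.Adj d y₅)
    (hd'4 : T.Adj y₄ d') (hd'0 : T.Adj y₀ d') (hd'5 : T.Adj d' y₅)
    (hpb : T.Adj p b) (hpd : T.Adj p d) (hpq : T.Adj p q) (hbq : T.Adj b q) (hdq : T.Adj d q)
    (hqd' : T.Adj q d') (hqp' : T.Adj q p') (hd'p' : T.Adj d' p') (hqb' : T.Adj q b')
    (hp'b' : T.Adj p' b')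
    (h5p : T.Adj y₅ p) (hp'0 : T.Adj p' y₀)
    (np0 : p ≠ y₀) (nq0 : q ≠ y₀) (np5 : p' ≠ y₅) (nq5 : q ≠ y₅) :
    T.Adj q y₀ ↔ T.Adj y₅ q := by
  constructor
  · intro hq0
    by_contra hn
    have hq5 := adj_of_not_adj nq5 hn
    -- If `p` is a backward neighbour of both ends, `y₁` and `b` complete a copy with extra vertex
    -- `q`; otherwise `d` completes one with extra vertex `y₄`.
    by_cases hp0 : T.Adj p y₀
    · exact not_isFree_L2 (x₀ := b) (x₁ := y₁) (x₂ := y₅) (x₃ := p) (x₄ := y₀) (y := q)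
        hb1 hb5 h15 h1p h5p h50 hp0 hpb hb0 h01 hbq h1q hpq hq5 hq0 hT
    · exact not_isFree_L2 (x₀ := y₀) (x₁ := p) (x₂ := d) (x₃ := q) (x₄ := y₅) (y := y₄)
        (adj_of_not_adj np0.symm hp0) hd0 hpd hpq hdq hd5 hq5 hq0 h50 h5p h04 hp4 hq4 hd4 h45 hT
  · intro h5q
    by_contra hn
    have h0q := adj_of_not_adj nq0.symm hn
    -- The same dichotomy on the other side of `q`, with `p'`, `b'`, `d'`.
    by_cases h5p' : T.Adj y₅ p'
    · exact not_isFree_L2 (x₀ := y₁) (x₁ := y₅) (x₂ := p') (x₃ := y₀) (x₄ := b') (y := q)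
        h15 h1p' h5p' h50 hp'0 hp'b' hb'0 h01 hb'1 hb'5 h1q h5q h0q hqp' hqb' hT
    · exact not_isFree_L2 (x₀ := y₀) (x₁ := q) (x₂ := d') (x₃ := p') (x₄ := y₅) (y := y₄)
        h0q hd'0 hqd' hqp' hd'p' hd'5 (adj_of_not_adj np5 h5p') hp'0 h50 h5q h04 hq4 hp'4 hd'4
        h45 hT

/-- Adding the elements of `P` one at a time, each step covers at most `L / 8` new vertices, so the
covered share cannot jump over the interval from `L / 8` to `L / 4`. -/
theorem exists_balanced_cover {β : Type*} (r : β → V → Prop) (A : Finset V) (L : ℕ)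
    (P : Finset β) (hdeg : ∀ q ∈ P, 8 * #{x ∈ A | r q x} ≤ L)
    (hcov : L ≤ 8 * #{x ∈ A | ∃ q ∈ P, r q x}) :
    ∃ P' ⊆ P, L ≤ 8 * #{x ∈ A | ∃ q ∈ P', r q x} ∧ 8 * #{x ∈ A | ∃ q ∈ P', r q x} ≤ 2 * L := by
  induction P using Finset.induction_on with
  | empty => exact ⟨∅, Subset.rfl, hcov, by simp⟩
  | insert q P hq ih =>
    by_cases h : L ≤ 8 * #{x ∈ A | ∃ q ∈ P, r q x}
    · obtain ⟨P', hP', h'⟩ := ih (fun q hq => hdeg q (mem_insert_of_mem hq)) h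
      exact ⟨P', hP'.trans (subset_insert _ _), h'⟩
    · refine ⟨insert q P, Subset.rfl, hcov, ?_⟩
      have hsub : {x ∈ A | ∃ q' ∈ insert q P, r q' x} ⊆
          {x ∈ A | r q x} ∪ {x ∈ A | ∃ q ∈ P, r q x} := by
        intro x
        simp only [mem_filter, mem_union, mem_insert, exists_eq_or_imp]
        tauto
      have h1 := (card_le_card hsub).trans (card_union_le _ _)
      have h2 := hdeg q (mem_insert_self _ _)
      omega

/-- If the neighbourhoods in `P` of the ends of every edge from `A` to `B` agree, then `A` and `B`
contain large subsets without edges between them. -/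
theorem exists_empty_pair {r s : V → V → Prop} {adj : V → V → Prop} {A B P : Finset V} {L M : ℕ}
    (hA : L ≤ 2 * #A) (hB : M ≤ 2 * #B) (hdeg : ∀ q ∈ P, 8 * #{x ∈ A | r q x} ≤ L)
    (hcov : ∀ x ∈ A, ∃ q ∈ P, r q x)
    (hagree : ∀ x ∈ A, ∀ y ∈ B, adj x y → ∀ q ∈ P, (r q x ↔ s q y)) :
    ∃ X ⊆ A, ∃ Y ⊆ B, L ≤ 8 * #X ∧ M ≤ 4 * #Y ∧ ∀ x ∈ X, ∀ y ∈ Y, ¬ adj x y := by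
  obtain ⟨P', hP', h1, h2⟩ := exists_balanced_cover r A L P hdeg
    (by rw [filter_true_of_mem hcov]; omega)
  have hA' := card_filter_add_card_filter_not (s := A) (fun x => ∃ q ∈ P', r q x)
  have hB' := card_filter_add_card_filter_not (s := B) (fun y => ∃ q ∈ P', s q y)
  -- Both the covered and the uncovered part of `A` have at least `L / 8` vertices; whichever part
  -- of `B` is larger is paired with the opposite part of `A`.
  by_cases h : M ≤ 4 * #{y ∈ B | ∃ q ∈ P', s q y}
  · refine ⟨{x ∈ A | ¬ ∃ q ∈ P', r q x}, filter_subset _ _, _, filter_subset _ _, by omega, h, ?_⟩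
    intro x hx y hy hxy
    obtain ⟨hx, hx'⟩ := mem_filter.1 hx
    obtain ⟨hy, q, hq, hqy⟩ := mem_filter.1 hy
    exact hx' ⟨q, hq, (hagree x hx y hy hxy q (hP' hq)).2 hqy⟩
  · refine ⟨{x ∈ A | ∃ q ∈ P', r q x}, filter_subset _ _, {y ∈ B | ¬ ∃ q ∈ P', s q y},
      filter_subset _ _, h1, by omega, ?_⟩
    intro x hx y hy hxy
    obtain ⟨hx, q, hq, hqx⟩ := mem_filter.1 hx
    obtain ⟨hy, hy'⟩ := mem_filter.1 hy
    exact hy' ⟨q, hq, (hagree x hx y hy hxy q (hP' hq)).1 hqx⟩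

/-! ### Typical vertices in the block structure -/

/-- A typical vertex of a block has few neighbours in the other blocks and in `Q`, but has
neighbours in prescribed pieces of `Q`. -/
theorem exists_typical_vertex {r u w : V → V → Prop} {B X Z Q G G' : Finset V}
    (hB : B.Nonempty)
    (hu : 20 * 2000 * relCount u B X ≤ #B * #X) (hw : 20 * 2000 * relCount w B Z ≤ #B * #Z)
    (hr : ∀ q ∈ Q, 2000 * #{y ∈ B | r q y} ≤ #B)
    (hG : 20 * #{y ∈ B | ∀ p ∈ G, ¬ r p y} ≤ #B) (hG' : 20 * #{y ∈ B | ∀ p ∈ G', ¬ r p y} ≤ #B) :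
    ∃ y ∈ B, 2000 * #{x ∈ X | u y x} ≤ #X ∧ 2000 * #{x ∈ Z | w y x} ≤ #Z ∧
      100 * #{q ∈ Q | r q y} ≤ #Q ∧ (∃ p ∈ G, r p y) ∧ ∃ p ∈ G', r p y := by
  -- Double counting, with `2000 = 20 * 100`: the 20 pays for the union bound, the 100 bounds the
  -- degree into `Q`.
  have hQ : 20 * 100 * relCount (fun y q => r q y) B Q ≤ #B * #Q := by
    rw [relCount_swap, relCount, mul_sum, mul_comm #B, ← smul_eq_mul #Q, ← sum_const]
    exact sum_le_sum hr
  obtain ⟨A, hAB, hA, hAv⟩ := exists_subset_avoid (B := B)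
    [{y ∈ B | #X < 2000 * #{x ∈ X | u y x}}, {y ∈ B | #Z < 2000 * #{x ∈ Z | w y x}},
      {y ∈ B | #Q < 100 * #{q ∈ Q | r q y}}, {y ∈ B | ∀ p ∈ G, ¬ r p y},
      {y ∈ B | ∀ p ∈ G', ¬ r p y}] (by simp) (by
        simp only [List.mem_cons, List.not_mem_nil, or_false, forall_eq_or_imp, forall_eq]
        exact ⟨card_large_degree_le hu, card_large_degree_le hw, card_large_degree_le hQ, hG, hG'⟩)
  obtain ⟨y, hy⟩ : A.Nonempty := by
    rw [← card_pos]
    have := hB.card_pos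
    omega
  have hyB := hAB hy
  have hyA := hAv y hy
  simp only [List.mem_cons, List.not_mem_nil, or_false, forall_eq_or_imp, forall_eq, mem_filter,
    hyB, true_and, not_lt, not_forall, not_not, exists_prop] at hyA
  exact ⟨y, hyB, hyA⟩

/-- Half of a block consists of vertices avoiding small sets and having neighbours in the sets
`P₁`, `P₂`, `P₃`. -/
theorem exists_typical_half {r : V → V → Prop} {B P₁ P₂ P₃ : Finset V} (l : List (V → Prop))
    (hl : l.length ≤ 7) (hu : ∀ u ∈ l, 2000 * #{x ∈ B | u x} ≤ #B)
    (h₁ : 20 * #{x ∈ B | ∀ p ∈ P₁, ¬ r p x} ≤ #B) (h₂ : 20 * #{x ∈ B | ∀ p ∈ P₂, ¬ r p x} ≤ #B)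
    (h₃ : 20 * #{x ∈ B | ∀ p ∈ P₃, ¬ r p x} ≤ #B) :
    ∃ A ⊆ B, #B ≤ 2 * #A ∧ ∀ x ∈ A, (∀ u ∈ l, ¬ u x) ∧ (∃ p ∈ P₁, r p x) ∧ (∃ p ∈ P₂, r p x) ∧
      ∃ p ∈ P₃, r p x := by
  obtain ⟨A, hAB, hA, hAv⟩ := exists_subset_avoid (B := B)
    ({x ∈ B | ∀ p ∈ P₁, ¬ r p x} :: {x ∈ B | ∀ p ∈ P₂, ¬ r p x} ::
      {x ∈ B | ∀ p ∈ P₃, ¬ r p x} :: l.map fun u : V → Prop => B.filter u)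
    (by simp only [List.length_cons, List.length_map]; omega) (by
      simp only [List.mem_cons, forall_eq_or_imp, List.forall_mem_map]
      refine ⟨h₁, h₂, h₃, fun u hul => ?_⟩
      have := hu u hul
      change 20 * #{x ∈ B | u x} ≤ #B
      omega)
  refine ⟨A, hAB, hA, fun x hx => ?_⟩
  have hxB := hAB hx
  have hxA := hAv x hx
  simp only [List.mem_cons, forall_eq_or_imp, List.forall_mem_map, mem_filter,
    hxB, true_and, not_forall, not_not, exists_prop] at hxA
  exact ⟨hxA.2.2.2, hxA.1, hxA.2.1, hxA.2.2.1⟩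

/-- Restricting to vertices of small degree does not shrink a piece of `Q` by much. -/
theorem card_le_two_mul_card_filter {Q P : Finset V} {u w : V → Prop} (hP : P ⊆ Q)
    (hQ : #Q ≤ 12 * #P) (hu : 100 * #{q ∈ Q | u q} ≤ #Q) (hw : 100 * #{q ∈ Q | w q} ≤ #Q) :
    #P ≤ 2 * #{q ∈ P | ¬ u q ∧ ¬ w q} := by
  have hsub : P ⊆ {q ∈ P | ¬ u q ∧ ¬ w q} ∪ ({q ∈ Q | u q} ∪ {q ∈ Q | w q}) := by
    intro x hx
    have := hP hx
    simp only [mem_filter, mem_union]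
    tauto
  have h1 := (card_le_card hsub).trans (card_union_le _ _)
  have h2 := card_union_le {q ∈ Q | u q} {q ∈ Q | w q}
  omega

/-- The combinatorial core: `c0`–`c5` supply backward neighbours in every large part of `Q`,
`g0`–`g5` keep single vertices of `Q` from covering much, and `hback` forbids the large empty pair
that would result. -/
theorem not_isFree_of_blocks {T : Tournament V} {B₀ B₁ B₄ B₅ Q : Finset V} {m : ℕ}
    {P : Fin 6 → Finset V} (hPQ : ∀ i, P i ⊆ Q) (hPm : ∀ i, #(P i) = m)
    (hPP : ∀ i j, i < j → ∀ p ∈ P i, ∀ q ∈ P j, T.Adj p q) (hQm : #Q ≤ 12 * m)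
    (n₁ : B₁.Nonempty) (n₄ : B₄.Nonempty)
    (e01 : Disjoint B₀ B₁) (e04 : Disjoint B₀ B₄) (e15 : Disjoint B₁ B₅) (e45 : Disjoint B₄ B₅)
    (e0 : Disjoint B₀ Q) (e1 : Disjoint B₁ Q) (e4 : Disjoint Q B₄) (e5 : Disjoint Q B₅)
    (s01 : 20 * 2000 * relCount (fun a b => T.Adj b a) B₀ B₁ ≤ #B₀ * #B₁)
    (s04 : 20 * 2000 * relCount (fun a b => T.Adj b a) B₀ B₄ ≤ #B₀ * #B₄)
    (s15 : 20 * 2000 * relCount (fun a b => T.Adj b a) B₁ B₅ ≤ #B₁ * #B₅)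
    (s45 : 20 * 2000 * relCount (fun a b => T.Adj b a) B₄ B₅ ≤ #B₄ * #B₅)
    (g0 : ∀ q ∈ Q, 2000 * #{x ∈ B₀ | T.Adj q x} ≤ #B₀)
    (g1 : ∀ q ∈ Q, 2000 * #{x ∈ B₁ | T.Adj q x} ≤ #B₁)
    (g4 : ∀ q ∈ Q, 2000 * #{x ∈ B₄ | T.Adj x q} ≤ #B₄)
    (g5 : ∀ q ∈ Q, 2000 * #{x ∈ B₅ | T.Adj x q} ≤ #B₅)
    (c0 : ∀ P ⊆ Q, m ≤ 2 * #P → 20 * #{x ∈ B₀ | ∀ p ∈ P, ¬ T.Adj p x} ≤ #B₀)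
    (c1 : ∀ P ⊆ Q, m ≤ 2 * #P → 20 * #{x ∈ B₁ | ∀ p ∈ P, ¬ T.Adj p x} ≤ #B₁)
    (c4 : ∀ P ⊆ Q, m ≤ 2 * #P → 20 * #{x ∈ B₄ | ∀ p ∈ P, ¬ T.Adj x p} ≤ #B₄)
    (c5 : ∀ P ⊆ Q, m ≤ 2 * #P → 20 * #{x ∈ B₅ | ∀ p ∈ P, ¬ T.Adj x p} ≤ #B₅)
    (hback : ∀ X ⊆ B₀, ∀ Y ⊆ B₅, #B₀ ≤ 20 * #X → #B₅ ≤ 20 * #Y → ∃ x ∈ X, ∃ y ∈ Y, T.Adj y x) :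
    ¬ T.IsFree L2 := by
  intro hT
  have hP2 : ∀ i, m ≤ 2 * #(P i) := fun i => by rw [hPm]; omega
  -- Pieces 0, 2, 4 will contain `p`, `q`, `p'`. The helpers `b`, `d` lie in piece 1, `d'` in piece
  -- 3 and `b'` in piece 5, as the order in `backward_nbrs_agree` demands.
  obtain ⟨y₁, hy₁, u10, u15, u1Q, ⟨b, hb, hb1⟩, b', hb', hb'1⟩ :=
    exists_typical_vertex (r := fun q y => T.Adj q y) (u := fun y x => T.Adj y x)
      (w := fun y x => T.Adj x y) (X := B₀) (Z := B₅) (G := P 1) (G' := P 5) n₁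
      (by rw [← relCount_swap, mul_comm #B₁]; exact s01) s15 g1
      (c1 _ (hPQ 1) (hP2 1)) (c1 _ (hPQ 5) (hP2 5))
  obtain ⟨y₄, hy₄, u40, u45, u4Q, ⟨d, hd, hd4⟩, d', hd', hd'4⟩ :=
    exists_typical_vertex (r := fun q y => T.Adj y q) (u := fun y x => T.Adj y x)
      (w := fun y x => T.Adj x y) (X := B₀) (Z := B₅) (G := P 1) (G' := P 3) n₄
      (by rw [← relCount_swap, mul_comm #B₄]; exact s04) s45 g4
      (c4 _ (hPQ 1) (hP2 1)) (c4 _ (hPQ 3) (hP2 3))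
  -- `p`, `q`, `p'` must also be joined forward to `y₁` and `y₄`; at least half of each piece
  -- survives, so `c0` and `c5` still apply.
  let R : Fin 6 → Finset V := fun i => {q ∈ P i | ¬ T.Adj q y₁ ∧ ¬ T.Adj y₄ q}
  have hRP : ∀ i, R i ⊆ P i := fun i => filter_subset _ _
  have hRQ : ∀ i, R i ⊆ Q := fun i => (hRP i).trans (hPQ i)
  have hRm : ∀ i, m ≤ 2 * #(R i) := fun i => by
    have := card_le_two_mul_card_filter (hPQ i) (by rw [hPm]; exact hQm) u1Q u4Q
    rwa [hPm] at this
  have hR1 : ∀ i, ∀ q ∈ R i, T.Adj y₁ q := fun i q hq =>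
    adj_of_not_adj (disjoint_left.1 e1 hy₁ |> fun h e => h (e ▸ hRQ i hq)) (mem_filter.1 hq).2.1
  have hR4 : ∀ i, ∀ q ∈ R i, T.Adj q y₄ := fun i q hq =>
    adj_of_not_adj (fun e => disjoint_left.1 e4 (hRQ i hq) (e ▸ hy₄)) (mem_filter.1 hq).2.2
  have hbQ := hPQ 1 hb
  have hb'Q := hPQ 5 hb'
  have hdQ := hPQ 1 hd
  have hd'Q := hPQ 3 hd'
  obtain ⟨A₀, hA₀B, hA₀, hA₀u⟩ := exists_typical_half (r := fun q x => T.Adj q x) (B := B₀)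
    (P₁ := R 0) (P₂ := R 2) (P₃ := R 4)
    [fun x => T.Adj y₁ x, fun x => T.Adj y₄ x, fun x => T.Adj b x, fun x => T.Adj b' x,
      fun x => T.Adj d x, fun x => T.Adj d' x] (by simp) (by
        simp only [List.mem_cons, List.not_mem_nil, or_false, forall_eq_or_imp, forall_eq]
        exact ⟨u10, u40, g0 b hbQ, g0 b' hb'Q, g0 d hdQ, g0 d' hd'Q⟩)
    (c0 _ (hRQ 0) (hRm 0)) (c0 _ (hRQ 2) (hRm 2)) (c0 _ (hRQ 4) (hRm 4))
  obtain ⟨A₅, hA₅B, hA₅, hA₅u⟩ := exists_typical_half (r := fun q x => T.Adj x q) (B := B₅)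
    (P₁ := R 0) (P₂ := R 2) (P₃ := R 4)
    [fun x => T.Adj x y₁, fun x => T.Adj x y₄, fun x => T.Adj x b, fun x => T.Adj x b',
      fun x => T.Adj x d, fun x => T.Adj x d'] (by simp) (by
        simp only [List.mem_cons, List.not_mem_nil, or_false, forall_eq_or_imp, forall_eq]
        exact ⟨u15, u45, g5 b hbQ, g5 b' hb'Q, g5 d hdQ, g5 d' hd'Q⟩)
    (c5 _ (hRQ 0) (hRm 0)) (c5 _ (hRQ 2) (hRm 2)) (c5 _ (hRQ 4) (hRm 4))
  simp only [List.mem_cons, List.not_mem_nil, or_false, forall_eq_or_imp, forall_eq] at hA₀u hA₅u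
  have key : ∀ x ∈ A₀, ∀ y ∈ A₅, T.Adj y x → ∀ q ∈ R 2, (T.Adj q x ↔ T.Adj y q) := by
    intro x hx y hy hyx q hq
    obtain ⟨⟨h1, h4, hb0, hb'0, hd0, hd'0⟩, -, -, p', hp', hp'x⟩ := hA₀u x hx
    obtain ⟨⟨h1', h4', hb5, hb'5, hd5, hd'5⟩, ⟨p, hp, hyp⟩, -, -⟩ := hA₅u y hy
    have hx := hA₀B hx
    have hy := hA₅B hy
    have hxQ : ∀ z ∈ Q, x ≠ z := fun z hz e => disjoint_left.1 e0 hx (e ▸ hz)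
    have hyQ : ∀ z ∈ Q, z ≠ y := fun z hz e => disjoint_left.1 e5 hz (e ▸ hy)
    have o : ∀ i j : Fin 6, i < j → ∀ p ∈ R i, ∀ q ∈ R j, T.Adj p q := fun i j hij p hp q hq =>
      hPP i j hij p (hRP i hp) q (hRP j hq)
    exact backward_nbrs_agree hT (y₁ := y₁) (y₄ := y₄) (p := p) (p' := p') (b := b) (b' := b')
      (d := d) (d' := d') hyx
      (adj_of_not_adj (fun e => disjoint_left.1 e01 hx (e ▸ hy₁)) h1)
      (adj_of_not_adj (fun e => disjoint_left.1 e04 hx (e ▸ hy₄)) h4)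
      (adj_of_not_adj (fun e => disjoint_left.1 e15 hy₁ (e ▸ hy)) h1')
      (adj_of_not_adj (fun e => disjoint_left.1 e45 hy₄ (e ▸ hy)) h4')
      (hR1 0 p hp) (hR1 4 p' hp') (hR1 2 q hq) (hR4 0 p hp) (hR4 4 p' hp') (hR4 2 q hq)
      hb1 (adj_of_not_adj (hxQ b hbQ) hb0) (adj_of_not_adj (hyQ b hbQ) hb5)
      hb'1 (adj_of_not_adj (hxQ b' hb'Q) hb'0) (adj_of_not_adj (hyQ b' hb'Q) hb'5)
      hd4 (adj_of_not_adj (hxQ d hdQ) hd0) (adj_of_not_adj (hyQ d hdQ) hd5)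
      hd'4 (adj_of_not_adj (hxQ d' hd'Q) hd'0) (adj_of_not_adj (hyQ d' hd'Q) hd'5)
      (hPP 0 1 (by decide) p (hRP 0 hp) b hb) (hPP 0 1 (by decide) p (hRP 0 hp) d hd)
      (o 0 2 (by decide) p hp q hq)
      (hPP 1 2 (by decide) b hb q (hRP 2 hq)) (hPP 1 2 (by decide) d hd q (hRP 2 hq))
      (hPP 2 3 (by decide) q (hRP 2 hq) d' hd') (o 2 4 (by decide) q hq p' hp')
      (hPP 3 4 (by decide) d' hd' p' (hRP 4 hp')) (hPP 2 5 (by decide) q (hRP 2 hq) b' hb')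
      (hPP 4 5 (by decide) p' (hRP 4 hp') b' hb') hyp hp'x
      (hxQ p (hRQ 0 hp)).symm (hxQ q (hRQ 2 hq)).symm (hyQ p' (hRQ 4 hp')) (hyQ q (hRQ 2 hq))
  obtain ⟨X, hX, Y, hY, hX8, hY4, hXY⟩ := exists_empty_pair (r := fun q x => T.Adj q x)
    (s := fun q y => T.Adj y q) (adj := fun x y => T.Adj y x) (P := R 2) hA₀ hA₅
    (fun q hq => by
      have h1 := g0 q (hRQ 2 hq)
      have h2 : #{x ∈ A₀ | T.Adj q x} ≤ #{x ∈ B₀ | T.Adj q x} :=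
        card_le_card (filter_subset_filter _ hA₀B)
      omega)
    (fun x hx => (hA₀u x hx).2.2.1) key
  obtain ⟨x, hx, y, hy, hyx⟩ := hback X (hX.trans hA₀B) Y (hY.trans hA₅B) (by omega) (by omega)
  exact hXY x hx y hy hyx

/-! ### The minimal counterexample -/

/-- The logarithmic lower bound on the size of transitive subtournaments. -/
theorem exists_transOn_card_lt_two_pow (T : Tournament V) (S : Finset V) :
    ∃ Q ⊆ S, T.TransOn Q ∧ #S < 2 ^ #Q := by
  induction S using Finset.strongInduction with
  | H S ih =>
    rcases S.eq_empty_or_nonempty with rfl | ⟨v, hv⟩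
    · exact ⟨∅, Subset.rfl, fun a ha => absurd ha (notMem_empty a), by simp⟩
    have hS : S = insert v ({w ∈ S | T.Adj v w} ∪ {w ∈ S | T.Adj w v}) := by
      ext w
      simp only [mem_insert, mem_union, mem_filter]
      constructor
      · intro hw
        by_cases hwv : w = v
        · exact Or.inl hwv
        · by_cases h : T.Adj v w
          · exact Or.inr (Or.inl ⟨hw, h⟩)
          · exact Or.inr (Or.inr ⟨hw, adj_of_not_adj hwv h⟩)
      · rintro (rfl | h | h)
        exacts [hv, h.1, h.1]
    have hcard : #S ≤ #{w ∈ S | T.Adj v w} + #{w ∈ S | T.Adj w v} + 1 := by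
      have h1 := congrArg card hS
      have h2 := card_insert_le v ({w ∈ S | T.Adj v w} ∪ {w ∈ S | T.Adj w v})
      have h3 := card_union_le {w ∈ S | T.Adj v w} {w ∈ S | T.Adj w v}
      omega
    have hsing : T.TransOn {v} := by
      intro a ha b hb c _ hab
      rw [mem_singleton.1 ha, mem_singleton.1 hb] at hab
      exact absurd hab (T.loopless v)
    -- Strictness absorbs the `+ 1`: `#R + 1 ≤ 2 ^ #Q` gives `2 * #R + 1 < 2 ^ (#Q + 1)`.
    have extend : ∀ R Q : Finset V, R ⊆ S → v ∉ Q → T.TransOn (Q ∪ {v}) → Q ⊆ R → #R < 2 ^ #Q →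
        #S ≤ 2 * #R + 1 → ∃ Q ⊆ S, T.TransOn Q ∧ #S < 2 ^ #Q := by
      intro R Q hRS hvQ hQ hQR hR hSR
      refine ⟨Q ∪ {v}, union_subset (hQR.trans hRS) (singleton_subset_iff.2 hv), hQ, ?_⟩
      rw [card_union_of_disjoint (disjoint_singleton_right.2 hvQ), card_singleton, pow_succ]
      omega
    rcases le_total #{w ∈ S | T.Adj v w} #{w ∈ S | T.Adj w v} with hle | hle
    · obtain ⟨Q, hQR, hQ, hlt⟩ := ih {w ∈ S | T.Adj w v} ⟨filter_subset _ _, fun hsub =>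
        T.loopless v (mem_filter.1 (hsub hv)).2⟩
      have hQv : ∀ q ∈ Q, T.Adj q v := fun q hq => (mem_filter.1 (hQR hq)).2
      refine extend _ Q (filter_subset _ _) (fun h => T.loopless v (hQv v h))
        (hQ.union hsing fun q hq w hw => ?_) hQR hlt (by omega)
      rw [mem_singleton.1 hw]
      exact hQv q hq
    · obtain ⟨Q, hQR, hQ, hlt⟩ := ih {w ∈ S | T.Adj v w} ⟨filter_subset _ _, fun hsub =>
        T.loopless v (mem_filter.1 (hsub hv)).2⟩
      have hQv : ∀ q ∈ Q, T.Adj v q := fun q hq => (mem_filter.1 (hQR hq)).2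
      refine extend _ Q (filter_subset _ _) (fun h => T.loopless v (hQv v h)) ?_ hQR hlt (by omega)
      rw [union_comm]
      refine hsing.union hQ fun w hw q hq => ?_
      rw [mem_singleton.1 hw]
      exact hQv q hq

/-- An `L2`-free tournament without transitive subtournaments on `N` vertices cannot have
transitive subtournaments on nearly `N` vertices in all of its large proper subsets. -/
theorem not_isFree_of_critical {T : Tournament V} {S : Finset V} {N : ℝ} {K : ℕ}
    (hN : 1000 ≤ N) (hS : 0 < #S) (htrans : ∀ Q ⊆ S, T.TransOn Q → (#Q : ℝ) < N)
    (hlarge : ∀ X ⊂ S, #S ≤ 20 * K * #X → ∃ Q ⊆ X, T.TransOn Q ∧ 99 / 100 * N ≤ #Q)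
    {A : Fin 5 → Finset V} (hAS : ∀ i, A i ⊆ S) (hA : ∀ i, #S ≤ K * #(A i))
    (hAA : ∀ i j, i < j → Disjoint (A i) (A j) ∧
      20 * 2000 * relCount (fun a b => T.Adj b a) (A i) (A j) ≤ #(A i) * #(A j)) :
    ¬ T.IsFree L2 := by
  have hpos : ∀ i, 0 < #(A i) := by
    intro i
    by_contra h
    have h0 : #(A i) = 0 := by omega
    have := hA i
    rw [h0] at this
    omega
  have hdis : ∀ i j, i ≠ j → Disjoint (A i) (A j) := by
    intro i j hij
    rcases lt_or_gt_of_ne hij with h | h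
    · exact (hAA i j h).1
    · exact (hAA j i h).1.symm
  have hproper : ∀ i, ∀ X ⊆ A i, X ⊂ S := by
    intro i X hX
    refine ⟨hX.trans (hAS i), fun hSX => ?_⟩
    obtain ⟨j, hj⟩ := exists_ne i
    obtain ⟨v, hv⟩ := card_pos.1 (hpos j)
    exact disjoint_left.1 (hdis j i hj) hv (hX (hSX (hAS j hv)))
  have hlin : ∀ i, ∀ X ⊆ A i, #(A i) ≤ 20 * #X →
      ∃ Q ⊆ X, T.TransOn Q ∧ 99 / 100 * N ≤ #Q := by
    intro i X hX hle
    refine hlarge X (hproper i X hX) ((hA i).trans ?_)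
    rw [mul_comm 20, mul_assoc]
    exact Nat.mul_le_mul_left _ hle
  have hunion : ∀ P ⊆ S, ∀ Q ⊆ S, T.TransOn P → T.TransOn Q → (∀ p ∈ P, ∀ q ∈ Q, T.Adj p q) →
      (#P : ℝ) + #Q < N := by
    intro P hPS Q hQS hP hQ hPQ
    have h := htrans _ (union_subset hPS hQS) (hP.union hQ hPQ)
    rwa [card_union_of_disjoint (disjoint_left.2 fun v hv hv' => T.loopless v (hPQ v hv v hv')),
      Nat.cast_add] at h
  have hsp : ∀ i j, i < j → 20 * 2000 * relCount (fun a b => T.Adj b a) (A i) (A j) ≤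
      #(A i) * #(A j) := fun i j hij => (hAA i j hij).2
  have hsp' : ∀ i j, i < j → 20 * 2000 * relCount (fun b a => T.Adj b a) (A j) (A i) ≤
      #(A j) * #(A i) := fun i j hij => by
    rw [← relCount_swap, mul_comm #(A j)]
    exact hsp i j hij
  obtain ⟨B, hBA, hB, hBu⟩ := exists_subset_avoid (B := A 2)
    [{q ∈ A 2 | #(A 0) < 2000 * #{x ∈ A 0 | T.Adj q x}},
      {q ∈ A 2 | #(A 1) < 2000 * #{x ∈ A 1 | T.Adj q x}},
      {q ∈ A 2 | #(A 3) < 2000 * #{x ∈ A 3 | T.Adj x q}},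
      {q ∈ A 2 | #(A 4) < 2000 * #{x ∈ A 4 | T.Adj x q}}] (by simp) (by
        simp only [List.mem_cons, List.not_mem_nil, or_false, forall_eq_or_imp, forall_eq]
        exact ⟨card_large_degree_le (hsp' 0 2 (by decide)),
          card_large_degree_le (hsp' 1 2 (by decide)), card_large_degree_le (hsp 2 3 (by decide)),
          card_large_degree_le (hsp 2 4 (by decide))⟩)
  obtain ⟨Q, hQB, hQ, hQN⟩ := hlin 2 B hBA (by omega)
  have hQA := hQB.trans hBA
  have hdeg : ∀ q ∈ Q, _ := fun q hq => hBu q (hQB hq)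
  simp only [List.mem_cons, List.not_mem_nil, or_false, forall_eq_or_imp, forall_eq, mem_filter,
    not_and, not_lt] at hdeg
  have hQ6 : 6 ≤ #Q := by
    have : (6 : ℝ) ≤ #Q := by linarith
    exact_mod_cast this
  obtain ⟨P, hPQ, hPm, hPP⟩ := hQ.exists_pieces (k := 6) (m := #Q / 6) (Nat.mul_div_le _ _)
  have hQm : #Q ≤ 12 * (#Q / 6) := by omega
  -- `99 / 100 / 24` exceeds `1 / 100`, so half a piece added to a transitive set of size `0.99 * N`
  -- already exceeds `N`.
  have hPN : ∀ P : Finset V, #Q / 6 ≤ 2 * #P → 1 / 100 * N < #P := by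
    intro P hP
    have h1 : #Q ≤ 24 * #P := by omega
    have h2 : (#Q : ℝ) ≤ 24 * #P := by exact_mod_cast h1
    linarith
  have hleft : ∀ i, i ≠ 2 → ∀ P ⊆ Q, #Q / 6 ≤ 2 * #P →
      20 * #{x ∈ A i | ∀ p ∈ P, ¬ T.Adj p x} ≤ #(A i) := by
    intro i hi P hP hPm
    by_contra! hlt
    obtain ⟨R, hRX, hR, hRN⟩ := hlin i _ (filter_subset _ _) hlt.le
    have := hunion R (hRX.trans ((filter_subset _ _).trans (hAS i))) P
      (hP.trans (hQA.trans (hAS 2))) hR (hQ.mono hP) fun x hx p hp => by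
        obtain ⟨hxA, hxP⟩ := mem_filter.1 (hRX hx)
        exact adj_of_not_adj (fun e => disjoint_left.1 (hdis i 2 hi) hxA (e ▸ hQA (hP hp)))
          (hxP p hp)
    linarith [hPN P hPm]
  have hright : ∀ i, i ≠ 2 → ∀ P ⊆ Q, #Q / 6 ≤ 2 * #P →
      20 * #{x ∈ A i | ∀ p ∈ P, ¬ T.Adj x p} ≤ #(A i) := by
    intro i hi P hP hPm
    by_contra! hlt
    obtain ⟨R, hRX, hR, hRN⟩ := hlin i _ (filter_subset _ _) hlt.le
    have := hunion P (hP.trans (hQA.trans (hAS 2))) R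
      (hRX.trans ((filter_subset _ _).trans (hAS i))) (hQ.mono hP) hR fun p hp x hx => by
        obtain ⟨hxA, hxP⟩ := mem_filter.1 (hRX hx)
        exact adj_of_not_adj (fun e => disjoint_left.1 (hdis i 2 hi) hxA (e ▸ hQA (hP hp)))
          (hxP p hp)
    linarith [hPN P hPm]
  refine not_isFree_of_blocks (B₀ := A 0) (B₁ := A 1) (B₄ := A 3) (B₅ := A 4) hPQ hPm hPP hQm
    (card_pos.1 (hpos 1)) (card_pos.1 (hpos 3))
    (hdis _ _ (by decide)) (hdis _ _ (by decide)) (hdis _ _ (by decide)) (hdis _ _ (by decide))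
    ((hdis 0 2 (by decide)).mono_right hQA) ((hdis 1 2 (by decide)).mono_right hQA)
    ((hdis 2 3 (by decide)).mono_left hQA) ((hdis 2 4 (by decide)).mono_left hQA)
    (hsp _ _ (by decide)) (hsp _ _ (by decide)) (hsp _ _ (by decide)) (hsp _ _ (by decide))
    (fun q hq => (hdeg q hq).1 (hQA hq)) (fun q hq => (hdeg q hq).2.1 (hQA hq))
    (fun q hq => (hdeg q hq).2.2.1 (hQA hq)) (fun q hq => (hdeg q hq).2.2.2 (hQA hq))
    (hleft 0 (by decide)) (hleft 1 (by decide)) (hright 3 (by decide)) (hright 4 (by decide)) ?_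
  intro X hX Y hY hXc hYc
  by_contra! hcon
  obtain ⟨R, hRX, hR, hRN⟩ := hlin 0 X hX hXc
  obtain ⟨R', hRY, hR', hRN'⟩ := hlin 4 Y hY hYc
  have := hunion R (hRX.trans (hX.trans (hAS 0))) R' (hRY.trans (hY.trans (hAS 4))) hR hR'
    fun x hx y hy => adj_of_not_adj
      (fun e => disjoint_left.1 (hdis 0 4 (by decide)) (hX (hRX hx)) (e ▸ hY (hRY hy)))
      (hcon x (hRX hx) y (hRY hy))
  linarith

/-- The first bound settles small cases via the logarithmic estimate; the second makes passing to a
`1 / K` share cost at most a factor `0.99`. -/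
theorem exists_small_exponent (K M : ℕ) (hK : 0 < K) (hM : 0 < M) :
    ∃ ε : ℝ, 0 < ε ∧ ε * M ≤ 1 ∧ (K : ℝ) ^ ε ≤ 100 / 99 := by
  have hK0 : (K : ℝ) ≠ 0 := by positivity
  have hcont : Filter.Tendsto (fun ε : ℝ => (K : ℝ) ^ ε) (nhdsWithin 0 (Set.Ioi 0)) (nhds 1) := by
    have := (Real.continuous_const_rpow hK0).tendsto 0
    rw [Real.rpow_zero] at this
    exact this.mono_left nhdsWithin_le_nhds
  have h1 := hcont.eventually (ge_mem_nhds (show (1 : ℝ) < 100 / 99 by norm_num))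
  have h2 : ∀ᶠ ε : ℝ in nhdsWithin 0 (Set.Ioi 0), ε ∈ Set.Ioo (0 : ℝ) (1 / M) :=
    Ioo_mem_nhdsGT (by positivity)
  obtain ⟨ε, h, hε, hεM⟩ := (h1.and h2).exists
  refine ⟨ε, hε, ?_, h⟩
  rw [lt_div_iff₀ (by positivity)] at hεM
  exact hεM.le

theorem exists_transOn_rpow_le : ∃ ε : ℝ, 0 < ε ∧ ∀ (V : Type u) (T : Tournament V),
    T.IsFree L2 → ∀ S : Finset V, ∃ Q ⊆ S, T.TransOn Q ∧ (#S : ℝ) ^ ε ≤ #Q := by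
  obtain ⟨K, N₀, hK, hblocks⟩ := exists_sparse_blocks.{u} L2 5 (D := 20 * 2000) (by norm_num)
  obtain ⟨ε, hε, hεM, hεK⟩ := exists_small_exponent (20 * K) (N₀ + 1000) (by omega) (by omega)
  refine ⟨ε, hε, fun V T hT S => ?_⟩
  induction S using Finset.strongInduction with
  | H S ih =>
    by_contra! hcon
    rcases S.eq_empty_or_nonempty with rfl | hS
    · have := hcon ∅ Subset.rfl fun a ha => absurd ha (notMem_empty a)
      simp [Real.zero_rpow hε.ne'] at this
    have hS1 := hS.card_pos
    obtain ⟨Q₀, hQ₀S, hQ₀, hlog⟩ := exists_transOn_card_lt_two_pow T S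
    have hQ₀N := hcon Q₀ hQ₀S hQ₀
    -- Otherwise `#S < 2 ^ #Q₀` gives `#S ^ ε ≤ 2`, so `#Q₀ < 2` and `S` is a single vertex, which
    -- is no counterexample.
    have hbig : N₀ + 1000 < #Q₀ := by
      by_contra! hle
      have hεq : #Q₀ * ε ≤ 1 := by
        have : (#Q₀ : ℝ) ≤ (N₀ + 1000 : ℕ) := by exact_mod_cast hle
        nlinarith
      have h2 : (#S : ℝ) ^ ε ≤ 2 := by
        calc (#S : ℝ) ^ ε ≤ ((2 : ℝ) ^ #Q₀) ^ ε := by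
              refine Real.rpow_le_rpow (by positivity) ?_ hε.le
              exact_mod_cast hlog.le
          _ = 2 ^ (#Q₀ * ε) := by rw [← Real.rpow_natCast, ← Real.rpow_mul (by norm_num)]
          _ ≤ 2 ^ (1 : ℝ) := Real.rpow_le_rpow_of_exponent_le (by norm_num) hεq
          _ = 2 := Real.rpow_one 2
      have hq : #Q₀ < 2 := by
        have : (#Q₀ : ℝ) < 2 := hQ₀N.trans_le h2
        exact_mod_cast this
      have hS2 : #S < 2 := hlog.trans_le (by
        calc 2 ^ #Q₀ ≤ 2 ^ 1 := Nat.pow_le_pow_right (by norm_num) (by omega)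
          _ = 2 := rfl)
      have hS3 : #S = 1 := by omega
      have hq0 : #Q₀ ≠ 0 := by
        intro h
        rw [h] at hlog
        omega
      rw [hS3, Nat.cast_one, Real.one_rpow] at hQ₀N
      have : #Q₀ < 1 := by exact_mod_cast hQ₀N
      omega
    have hQ₀c := card_le_card hQ₀S
    obtain ⟨A, hAS, hA, hAA⟩ := hblocks V T hT S (by omega)
    refine not_isFree_of_critical (N := (#S : ℝ) ^ ε) ?_ hS1 hcon ?_ hAS hA hAA hT
    · have : ((N₀ + 1000 : ℕ) : ℝ) < #Q₀ := by exact_mod_cast hbig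
      push_cast at this
      have h0 : (0 : ℝ) ≤ N₀ := Nat.cast_nonneg _
      linarith
    · intro X hX hXc
      obtain ⟨Q, hQX, hQ, hQc⟩ := ih X hX
      refine ⟨Q, hQX, hQ, le_trans ?_ hQc⟩
      have h1 : (#S : ℝ) ^ ε ≤ ((20 * K : ℕ) : ℝ) ^ ε * (#X : ℝ) ^ ε := by
        rw [← Real.mul_rpow (by positivity) (by positivity)]
        refine Real.rpow_le_rpow (by positivity) ?_ hε.le
        exact_mod_cast hXc
      have h2 : (0 : ℝ) ≤ (#X : ℝ) ^ ε := by positivity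
      have h3 := mul_le_mul_of_nonneg_right hεK h2
      linarith

end
end Tournament

theorem mainTheorem2 : Tournament.HasErdosHajnalProperty.{u} Tournament.L2 := by
  obtain ⟨ε, hε, h⟩ := Tournament.exists_transOn_rpow_le.{u}
  refine ⟨ε, hε, fun V _ T hT => ?_⟩
  obtain ⟨Q, -, hQ, hc⟩ := h V T hT Finset.univ
  exact ⟨Q, hQ.isTransitive, hc⟩
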